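/- Let $\mathbb N=\{0,1,2,\dots\}$. A family $\mathcal F$ of finite subsets of $\mathbb N$ is *compact* if it is closed in $\{0,1\}^{\mathbb N}$ (finite sets being identified with their characteristic functions), and *hereditary* if $s\subseteq t\in\mathcal F$ implies $s\in\mathcal F$. Let $M\subseteq\mathbb N$ be infinite. A family $\mathcal B$ of finite subsets of $M$ is *regular on $M$* if it is compact, hereditary and *spreading on $M$*: whenever $\{s_1<\dots<s_d\}\in\mathcal B$, $\{t_1<\dots<t_d\}\subseteq M$ and $s_i\le t_i$ for all $i$, then $\{t_1,\dots,t_d\}\in\mathcal B$; *regular* means regular on $\mathbb N$. Let $\partial\mathcal F$ be the set of accumulation points of $\mathcal F$ in $\mathcal F$, let $\partial^{(0)}\mathcal F=\mathcal F$ and $\partial^{(\alpha)}\mathcal F=\bigcap_{\beta<\alpha}\partial(\partial^{(\beta)}\mathcal F)$ for $\alpha>0$; for compact $\mathcal F$ let $\iota(\mathcal F)$ be the least ordinal $\alpha$ with $\partial^{(\alpha)}\mathcal F\subseteq\{\emptyset\}$. A finite sequence $(s_i)_{i<n}$ of non-empty finite sets is a *block sequence* if $\max s_i<\min s_{i+1}$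 for all $i$. A set $t=\{m_0<\dots<m_{n-1}\}$ *interpolates* it if $m_i\le\min s_i$ for all $i<n$ and $\max s_i<m_{i+1}$ for all $i<n-1$. A block sequence is *$\mathcal F$-admissible* if some $t\in\mathcal F$ interpolates it. Let $\mathcal B^{\sqsubseteq\text{-}\max}$ be the set of those $s\in\mathcal B$ that are not a proper initial segment of an element of $\mathcal B$, and let $\mathcal G\restriction N=\{s\in\mathcal G: s\subseteq N\}$. Let $\mathcal F$ be a compact hereditary family of finite subsets of $\mathbb N$ and let $M\subseteq\mathbb N$ be infinite. (a) There are a regular family $\mathcal B$ with $\iota(\mathcal B)=\iota(\mathcal F)$ and an infinite $N\subseteq M$ such that every $\mathcal B$-admissible sequence of subsets of $N$ is $\mathcal F$-admissible. (b) For every family $\mathcal B$ that is regular on $M$ and satisfies $\iota(\mathcal B)>\iota(\mathcal F)$ there is an infinite $N\subseteq M$ such that no $(\mathcal B^{\sqsubseteq\text{-}\max}\restriction N)$-admissible sequence $(s_i)$ of subsets of $N$ with $\#s_i\ge 2$ for all $i$ is $\mathcal F$-admissible. -/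

import Mathlib

open Topology Filter

/-- The characteristic function of a finite set of natural numbers, as a point of the
Cantor space `ℕ → Bool` (product topology). -/
def charFun (s : Finset ℕ) : ℕ → Bool := fun n => decide (n ∈ s)

/-- A family of finite sets is compact if it is a compact (equivalently, closed) subset of the
Cantor space, finite sets being identified with their characteristic functions. -/
def IsCompactFamily (F : Set (Finset ℕ)) : Prop := IsCompact (charFun '' F)

/-- Hereditary: closed under subsets. -/
def IsHereditary (F : Set (Finset ℕ)) : Prop := ∀ s t : Finset ℕ, s ⊆ t → t ∈ F → s ∈ F

/-- `Precedes s t`: `s` and `t` have the same number `d` of elements, and, in increasing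
enumerations `s = {s₀ < s₁ < …}` and `t = {t₀ < t₁ < …}`, one has `sᵢ ≤ tᵢ` for all `i < d`. -/
def Precedes (s t : Finset ℕ) : Prop :=
  ∃ (d : ℕ) (a b : Fin d → ℕ), StrictMono a ∧ StrictMono b ∧
    Finset.univ.image a = s ∧ Finset.univ.image b = t ∧ ∀ i, a i ≤ b i

/-- `F` is a family of finite subsets of `M` which is spreading on `M`. -/
def IsSpreadingOn (M : Set ℕ) (F : Set (Finset ℕ)) : Prop :=
  (∀ s ∈ F, (s : Set ℕ) ⊆ M) ∧
    ∀ s t : Finset ℕ, Precedes s t → (t : Set ℕ) ⊆ M → s ∈ F → t ∈ F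

/-- `F` is regular on `M`: compact, hereditary and spreading on `M`. -/
def IsRegularOn (M : Set ℕ) (F : Set (Finset ℕ)) : Prop :=
  IsCompactFamily F ∧ IsHereditary F ∧ IsSpreadingOn M F

/-- `F` is regular: regular on `ℕ`. -/
def IsRegularFamily (F : Set (Finset ℕ)) : Prop := IsRegularOn Set.univ F

/-- The derivative `∂F`: the elements of `F` that are accumulation points of `F`. -/
def derivFamily (F : Set (Finset ℕ)) : Set (Finset ℕ) :=
  {s | s ∈ F ∧ AccPt (charFun s) (𝓟 (charFun '' F))}

/-- The iterated derivatives: `∂⁽⁰⁾F = F` and `∂⁽ᵅ⁾F = ⋂_{β < α} ∂(∂⁽ᵝ⁾F)` for `α > 0`. -/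
def iterDerivFamily (F : Set (Finset ℕ)) (α : Ordinal.{0}) : Set (Finset ℕ) :=
  {s | s ∈ F ∧ ∀ β : Ordinal.{0}, β < α → s ∈ derivFamily (iterDerivFamily F β)}
termination_by α

/-- The Cantor-Bendixson index `ι(F)` of a compact family: the least ordinal `α` such that
`∂⁽ᵅ⁾F ⊆ {∅}`. -/
noncomputable def cbIndex (F : Set (Finset ℕ)) : Ordinal.{0} :=
  sInf {α : Ordinal.{0} | iterDerivFamily F α ⊆ {∅}}

/-- `max s < min t` for (nonempty) finite sets `s`, `t`. -/
def SetLT (s t : Finset ℕ) : Prop := ∀ a ∈ s, ∀ b ∈ t, a < b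

/-- A finite block sequence of (nonempty) finite sets: `s₀ < s₁ < … < sₙ₋₁`. -/
def IsBlockSeq {n : ℕ} (s : Fin n → Finset ℕ) : Prop :=
  (∀ i, (s i).Nonempty) ∧ ∀ i j, i < j → SetLT (s i) (s j)

/-- `t = {m₀ < … < mₙ₋₁}` interpolates `(sᵢ)_{i < n}`: `m₀ ≤ s₀ < m₁ ≤ s₁ < … < mₙ₋₁ ≤ sₙ₋₁`. -/
def Interpolates (t : Finset ℕ) {n : ℕ} (s : Fin n → Finset ℕ) : Prop :=
  ∃ m : Fin n → ℕ, StrictMono m ∧ Finset.univ.image m = t ∧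
    (∀ i, ∀ a ∈ s i, m i ≤ a) ∧ ∀ i j, i < j → ∀ a ∈ s i, a < m j

/-- A block sequence is `F`-admissible if some element of `F` interpolates it. -/
def Admissible (F : Set (Finset ℕ)) {n : ℕ} (s : Fin n → Finset ℕ) : Prop :=
  IsBlockSeq s ∧ ∃ t ∈ F, Interpolates t s

/-- `s` is an initial segment of `t`. -/
def IsInitialSegment (s t : Finset ℕ) : Prop := s ⊆ t ∧ ∀ a ∈ s, ∀ b ∈ t, b ∉ s → a < b

/-- The set of elements of `F` that are maximal for the initial segment order. -/
def initMax (F : Set (Finset ℕ)) : Set (Finset ℕ) :=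
  {s | s ∈ F ∧ ∀ t ∈ F, IsInitialSegment s t → t = s}

/-- The restriction of `F` to `N`: the elements of `F` that are subsets of `N`. -/
def restrictFamily (F : Set (Finset ℕ)) (N : Set ℕ) : Set (Finset ℕ) :=
  {s | s ∈ F ∧ (s : Set ℕ) ⊆ N}

/-! ### Derivatives of hereditary families -/

/-! For hereditary families, membership in `∂⁽ᵅ⁾F` is a game: `s` lies there iff `s ∈ F` and, for
each `β < α`, arbitrarily late `m` put `s ∪ {m}` in `∂⁽ᵝ⁾F` (`mem_iterDerivFamily_iff`). Both halves
play this game along the blocks, on a set `N` sparse enough that each threshold needed is passed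
within one step of `N`.

(a) `B` consists of the sets labelled by strictly decreasing ordinals below `ι(F)`, where a given
bound on the labelled element leaves only finitely many labels. Its index is `ι(F)`. If `t ∈ B`
interpolates the blocks, its labels dictate the moves in `F`: points `m₀ < m₁ < …` are chosen
between the blocks so that `{m₀, …, mᵢ}` lies in the derivative of `F` given by the label of `tᵢ`.

(b) Suppose `t ∈ B` and `u ∈ F` interpolate the same blocks. At the first points the ordinal `ι(F)`
separates the rank of `t` from that of `u`. By spreading, later points keep some separating ordinal
(`eventually_rankGT_insert`). At the end `t` still lies in a positive derivative of `B`, so it has a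
proper end-extension there and is not maximal. -/

theorem charFun_injective : Function.Injective charFun := by
  intro s t h
  ext a
  simpa [charFun] using congrFun h a

theorem tendsto_charFun_insert (s : Finset ℕ) :
    Tendsto (fun m => charFun (insert m s)) atTop (𝓝 (charFun s)) := by
  refine tendsto_pi_nhds.2 fun i => tendsto_nhds_of_eventually_eq ?_
  filter_upwards [eventually_gt_atTop i] with m hm
  simp [charFun, hm.ne]

/-- Every neighbourhood of the characteristic function of `s` contains all characteristic functions
that agree with it below some bound. -/
theorem agree_below_mem_nhds (x : ℕ → Bool) (k : ℕ) : {y | ∀ i < k, y i = x i} ∈ 𝓝 x := by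
  have := set_pi_mem_nhds (s := fun i => {x i}) (x := x) (Set.finite_Iio k)
    (fun a _ => by simp [nhds_discrete])
  exact mem_of_superset this fun y hy i hi => by simpa using hy i hi

/-- A member of `G` close to `s` but different from it contains `s` and some far element; heredity
discards the rest. Conversely `s ∪ {m}` tends to `s`. -/
theorem mem_derivFamily_iff {G : Set (Finset ℕ)} (hG : IsHereditary G) (s : Finset ℕ) :
    s ∈ derivFamily G ↔
      s ∈ G ∧ ∃ᶠ m in atTop, (∀ x ∈ s, x < m) ∧ insert m s ∈ G := by
  refine and_congr_right fun hs => ⟨fun h => ?_, fun h => ?_⟩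
  · refine frequently_atTop.2 fun k => ?_
    obtain ⟨y, ⟨hyU, t, ht, rfl⟩, hne⟩ :=
      accPt_iff_nhds.1 h _ (agree_below_mem_nhds (charFun s) (max k (s.sup id + 1)))
    have hlt : ∀ a ∈ s, a < max k (s.sup id + 1) := fun a ha =>
      lt_max_of_lt_right (Nat.lt_succ_of_le (Finset.le_sup (f := id) ha))
    have hagree : ∀ i < max k (s.sup id + 1), (i ∈ t ↔ i ∈ s) := fun i hi => by
      simpa [charFun] using hyU i hi
    have hst : s ⊆ t := fun a ha => (hagree a (hlt a ha)).2 ha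
    obtain ⟨m, hmt, hms⟩ : ∃ m ∈ t, m ∉ s := by
      by_contra! hcon
      exact hne (congrArg charFun (Finset.Subset.antisymm hcon hst))
    have hm : max k (s.sup id + 1) ≤ m := by
      by_contra! hlt'
      exact hms ((hagree m hlt').1 hmt)
    exact ⟨m, (le_max_left _ _).trans hm, fun x hx => (hlt x hx).trans_le hm,
      hG _ t (Finset.insert_subset hmt hst) ht⟩
  · refine accPt_iff_frequently.2 ((tendsto_charFun_insert s).frequently (h.mono ?_))
    rintro m ⟨hm, hmG⟩
    refine ⟨fun heq => ?_, Set.mem_image_of_mem _ hmG⟩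
    have : m ∈ s := charFun_injective heq ▸ Finset.mem_insert_self m s
    exact (hm m this).false

theorem IsHereditary.derivFamily {G : Set (Finset ℕ)} (hG : IsHereditary G) :
    IsHereditary (derivFamily G) := by
  intro s t hst ht
  rw [mem_derivFamily_iff hG] at ht ⊢
  exact ⟨hG _ _ hst ht.1, ht.2.mono fun m hm =>
    ⟨fun x hx => hm.1 x (hst hx), hG _ _ (Finset.insert_subset_insert m hst) hm.2⟩⟩

theorem mem_iterDerivFamily_def {F : Set (Finset ℕ)} {α : Ordinal.{0}} {s : Finset ℕ} :
    s ∈ iterDerivFamily F α ↔ s ∈ F ∧ ∀ β < α, s ∈ derivFamily (iterDerivFamily F β) := by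
  rw [iterDerivFamily]
  rfl

theorem iterDerivFamily_subset (F : Set (Finset ℕ)) (α : Ordinal.{0}) :
    iterDerivFamily F α ⊆ F := fun _ hs => (mem_iterDerivFamily_def.1 hs).1

theorem iterDerivFamily_zero (F : Set (Finset ℕ)) : iterDerivFamily F 0 = F := by
  ext s
  rw [mem_iterDerivFamily_def]
  simp

theorem IsHereditary.iterDerivFamily {F : Set (Finset ℕ)} (hF : IsHereditary F)
    (α : Ordinal.{0}) : IsHereditary (iterDerivFamily F α) := by
  induction α using WellFoundedLT.induction with
  | ind α ih =>
    intro s t hst ht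
    rw [mem_iterDerivFamily_def] at ht ⊢
    exact ⟨hF s t hst ht.1, fun β hβ => (ih β hβ).derivFamily s t hst (ht.2 β hβ)⟩

theorem mem_iterDerivFamily_iff {F : Set (Finset ℕ)} (hF : IsHereditary F) {α : Ordinal.{0}}
    {s : Finset ℕ} :
    s ∈ iterDerivFamily F α ↔ s ∈ F ∧ ∀ β < α,
      ∃ᶠ m in atTop, (∀ x ∈ s, x < m) ∧ insert m s ∈ iterDerivFamily F β := by
  rw [mem_iterDerivFamily_def]
  refine and_congr_right fun _ => forall₂_congr fun β _ => ?_
  rw [mem_derivFamily_iff (hF.iterDerivFamily β), and_iff_right_iff_imp]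
  intro h
  obtain ⟨m, -, hm⟩ := h.exists
  exact hF.iterDerivFamily β _ _ (Finset.subset_insert m s) hm

/-- A hereditary family has a nonempty set in a given derivative iff it has a singleton there. -/
theorem exists_singleton_mem_of_not_subset {G : Set (Finset ℕ)} (hG : IsHereditary G)
    (h : ¬ G ⊆ {∅}) : ∃ m, {m} ∈ G := by
  obtain ⟨s, hs, hne⟩ := Set.not_subset.1 h
  obtain ⟨m, hm⟩ := Finset.nonempty_iff_ne_empty.2 hne
  exact ⟨m, hG _ s (Finset.singleton_subset_iff.2 hm) hs⟩

/-! ### Compactness and the rank of a compact family -/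

/-- By heredity, all finite subsets of the support of a limit point lie in `F`, so the hypothesis
makes that support finite and hence a member. -/
theorem IsHereditary.isCompactFamily {F : Set (Finset ℕ)} (hF : IsHereditary F)
    (h : ∀ X : Set ℕ, (∀ s : Finset ℕ, (s : Set ℕ) ⊆ X → s ∈ F) → X.Finite) :
    IsCompactFamily F := by
  refine IsClosed.isCompact (isClosed_of_closure_subset fun x hx => ?_)
  have key : ∀ s : Finset ℕ, (s : Set ℕ) ⊆ {n | x n = true} → s ∈ F := by
    intro s hs
    obtain ⟨_, hy, t, ht, rfl⟩ :=
      mem_closure_iff_nhds.1 hx _ (agree_below_mem_nhds x (s.sup id + 1))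
    refine hF s t (fun a ha => ?_) ht
    have := hy a (Nat.lt_succ_of_le (Finset.le_sup (f := id) ha))
    rw [show x a = true from hs ha] at this
    simpa [charFun] using this
  have hfin := h _ key
  refine ⟨hfin.toFinset, key _ (by simp), ?_⟩
  ext n
  cases hn : x n <;> simp [charFun, hn]

/-- Strict inclusion between members of `F`, the larger set being the smaller one. -/
def ProperSupersetIn (F : Set (Finset ℕ)) (t s : Finset ℕ) : Prop := t ∈ F ∧ s ⊂ t

/-- An infinite strictly increasing chain would converge to its infinite union, which closedness
forces to be a finite set. -/
theorem IsCompactFamily.wellFounded {F : Set (Finset ℕ)} (hF : IsCompactFamily F) :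
    WellFounded (ProperSupersetIn F) := by
  refine wellFounded_iff_isEmpty_descending_chain.2 ⟨fun ⟨f, hf⟩ => ?_⟩
  have hmono : StrictMono f := strictMono_nat_of_lt_succ fun n => (hf n).2
  let X : Set ℕ := ⋃ n, (f n : Set ℕ)
  classical
  have hlim : Tendsto (fun n => charFun (f (n + 1))) atTop (𝓝 fun i => decide (i ∈ X)) := by
    refine tendsto_pi_nhds.2 fun i => tendsto_nhds_of_eventually_eq ?_
    by_cases hi : i ∈ X
    · obtain ⟨k, hk⟩ := Set.mem_iUnion.1 hi
      filter_upwards [eventually_ge_atTop k] with m hm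
      have : i ∈ f (m + 1) := hmono.monotone (hm.trans (Nat.le_succ m)) hk
      simp [charFun, this, hi]
    · refine Eventually.of_forall fun m => ?_
      have : i ∉ f (m + 1) := fun h => hi (Set.mem_iUnion.2 ⟨m + 1, h⟩)
      simp [charFun, this, hi]
  obtain ⟨t, -, ht⟩ := hF.isClosed.mem_of_tendsto hlim
    (Eventually.of_forall fun n => Set.mem_image_of_mem _ (hf n).1)
  have hsub : ∀ n, f n ⊆ t := fun n a ha => by
    have h1 := congrFun ht a
    have h2 : a ∈ X := Set.mem_iUnion.2 ⟨n, ha⟩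
    simpa [charFun, h2] using h1
  have hinj : Set.InjOn f Set.univ := hmono.injective.injOn
  exact Set.infinite_univ ((t.powerset.finite_toSet.subset
    (by rintro _ ⟨n, -, rfl⟩; simpa using hsub n)).of_finite_image hinj)

/-- Each `β < α` yields a proper superset of `s` in `∂⁽ᵝ⁾F`, of smaller rank. The bound shows that
the infimum defining `cbIndex` is attained. -/
theorem IsCompactFamily.le_rank {F : Set (Finset ℕ)} (hF : IsCompactFamily F)
    (hh : IsHereditary F) (s : Finset ℕ) (α : Ordinal.{0}) (hs : s ∈ iterDerivFamily F α) :
    α ≤ (hF.wellFounded.apply s).rank := by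
  induction s using hF.wellFounded.induction generalizing α with
  | _ s ih =>
    refine le_of_forall_lt fun β hβ => ?_
    obtain ⟨m, hm, hmF⟩ := (((mem_iterDerivFamily_iff hh).1 hs).2 β hβ).exists
    have hrel : ProperSupersetIn F (insert m s) s :=
      ⟨iterDerivFamily_subset _ _ hmF, Finset.ssubset_insert fun h => (hm m h).false⟩
    exact (ih _ hrel β hmF).trans_lt (Acc.rank_lt_of_rel (hF.wellFounded.apply s) hrel)

theorem IsCompactFamily.iterDerivFamily_cbIndex {F : Set (Finset ℕ)} (hF : IsCompactFamily F)
    (hh : IsHereditary F) : iterDerivFamily F (cbIndex F) ⊆ {∅} := by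
  refine csInf_mem (s := {α : Ordinal.{0} | iterDerivFamily F α ⊆ {∅}})
    ⟨Order.succ (hF.wellFounded.apply ∅).rank, fun s hs => ?_⟩
  have h0 := hh.iterDerivFamily _ ∅ s (Finset.empty_subset s) hs
  exact absurd (Order.lt_succ _) (hF.le_rank hh ∅ _ h0).not_gt

theorem exists_singleton_mem_of_lt_cbIndex {F : Set (Finset ℕ)} (hh : IsHereditary F)
    {γ : Ordinal.{0}} (hγ : γ < cbIndex F) : ∃ m, {m} ∈ iterDerivFamily F γ :=
  exists_singleton_mem_of_not_subset (hh.iterDerivFamily γ) (notMem_of_lt_csInf' hγ)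

theorem cbIndex_eq {F : Set (Finset ℕ)} {ι : Ordinal.{0}} (h : iterDerivFamily F ι ⊆ {∅})
    (h' : ∀ γ < ι, ¬ iterDerivFamily F γ ⊆ {∅}) : cbIndex F = ι :=
  le_antisymm (csInf_le' h) (le_csInf ⟨ι, h⟩ fun γ hγ => not_lt.1 fun hlt => h' γ hlt hγ)

/-- Ranks form an initial segment of the ordinals, and there are only countably many finite sets to
carry them. -/
theorem IsCompactFamily.countable_Iio_cbIndex {F : Set (Finset ℕ)} (hF : IsCompactFamily F)
    (hh : IsHereditary F) : (Set.Iio (cbIndex F)).Countable := by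
  refine (Set.countable_range fun s => (hF.wellFounded.apply s).rank).mono fun γ hγ => ?_
  obtain ⟨m, hm⟩ := exists_singleton_mem_of_lt_cbIndex hh hγ
  obtain ⟨b, hb, h⟩ := Acc.mem_range_rank_of_le (hF.wellFounded.apply {m}) (hF.le_rank hh _ _ hm)
  exact ⟨b, h⟩

/-! ### Sparse sequences and initial parts of finite sequences -/

/-- In an infinite set one finds a sequence whose successive terms meet conditions that hold for
all large numbers. -/
theorem Set.Infinite.exists_sparse {M : Set ℕ} (hM : M.Infinite) {P₀ : ℕ → Prop}
    {P : ℕ → ℕ → ℕ → Prop} (h₀ : ∀ᶠ b in atTop, P₀ b) (h : ∀ k a, ∀ᶠ b in atTop, P k a b) :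
    ∃ N : ℕ → ℕ, StrictMono N ∧ (∀ k, N k ∈ M) ∧ P₀ (N 0) ∧ ∀ k, P k (N k) (N (k + 1)) := by
  have hfr : ∃ᶠ b in atTop, b ∈ M := Nat.frequently_atTop_iff_infinite.2 hM
  obtain ⟨b₀, hb₀M, hb₀⟩ := (hfr.and_eventually h₀).exists
  have hstep : ∀ k a, ∃ b, b ∈ M ∧ P k a b ∧ a < b := fun k a =>
    (hfr.and_eventually ((h k a).and (eventually_gt_atTop a))).exists
  choose f hfM hfP hf using hstep
  let N : ℕ → ℕ := fun k => Nat.rec b₀ (fun k a => f k a) k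
  refine ⟨N, strictMono_nat_of_lt_succ fun k => hf k (N k), fun k => ?_, hb₀, fun k => hfP k _⟩
  cases k with
  | zero => exact hb₀M
  | succ k => exact hfM k _

/-- The set of the first `j` values of a finite sequence. -/
def headImage {n : ℕ} (m : Fin n → ℕ) (j : ℕ) : Finset ℕ :=
  (Finset.univ.filter fun i : Fin n => i.val < j).image m

theorem mem_headImage {n : ℕ} {m : Fin n → ℕ} {j a : ℕ} :
    a ∈ headImage m j ↔ ∃ i : Fin n, i.val < j ∧ m i = a := by
  simp [headImage]

theorem headImage_zero {n : ℕ} (m : Fin n → ℕ) : headImage m 0 = ∅ := by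
  simp [headImage]

theorem headImage_self {n : ℕ} (m : Fin n → ℕ) : headImage m n = Finset.univ.image m := by
  simp [headImage]

theorem headImage_subset {n : ℕ} (m : Fin n → ℕ) (j : ℕ) :
    headImage m j ⊆ Finset.univ.image m := by
  intro a ha
  obtain ⟨i, -, rfl⟩ := mem_headImage.1 ha
  simp

theorem headImage_succ {n : ℕ} (m : Fin n → ℕ) {j : ℕ} (hj : j < n) :
    headImage m (j + 1) = insert (m ⟨j, hj⟩) (headImage m j) := by
  ext a
  simp only [Finset.mem_insert, mem_headImage]
  constructor
  · rintro ⟨i, hi, rfl⟩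
    rcases Nat.lt_succ_iff_lt_or_eq.1 hi with h | h
    · exact Or.inr ⟨i, h, rfl⟩
    · exact Or.inl (congrArg m (Fin.ext h))
  · rintro (rfl | ⟨i, hi, rfl⟩)
    · exact ⟨_, Nat.lt_succ_self _, rfl⟩
    · exact ⟨i, hi.trans (Nat.lt_succ_self _), rfl⟩

theorem headImage_update {n : ℕ} (m : Fin n → ℕ) {j : ℕ} (hj : j < n) (b : ℕ) :
    headImage (Function.update m ⟨j, hj⟩ b) (j + 1) = insert b (headImage m j) := by
  rw [headImage_succ _ hj, Function.update_self]
  congr 1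
  refine Finset.image_congr fun i hi => Function.update_of_ne ?_ _ _
  rintro rfl
  simp at hi

/-! ### Spreading families -/

theorem precedes_refl (s : Finset ℕ) : Precedes s s :=
  ⟨s.card, s.orderEmbOfFin rfl, s.orderEmbOfFin rfl, (s.orderEmbOfFin rfl).strictMono,
    (s.orderEmbOfFin rfl).strictMono, by simp, by simp, fun _ => le_rfl⟩

theorem strictMono_snoc {d : ℕ} {a : Fin d → ℕ} (ha : StrictMono a) {m : ℕ}
    (h : ∀ i, a i < m) : StrictMono (Fin.snoc a m : Fin (d + 1) → ℕ) := by
  intro i j hij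
  induction j using Fin.lastCases with
  | last =>
    induction i using Fin.lastCases with
    | last => exact absurd hij (lt_irrefl _)
    | cast i => simpa using h i
  | cast j =>
    induction i using Fin.lastCases with
    | last => exact absurd hij (Fin.le_last _).not_gt
    | cast i => simpa using ha (by simpa using hij)

theorem image_snoc {d : ℕ} (a : Fin d → ℕ) (m : ℕ) :
    Finset.univ.image (Fin.snoc a m : Fin (d + 1) → ℕ) = insert m (Finset.univ.image a) := by
  ext x
  simp [Fin.exists_fin_succ', or_comm, eq_comm]

theorem Precedes.insert {s t : Finset ℕ} (h : Precedes s t) {m m' : ℕ} (hs : ∀ x ∈ s, x < m)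
    (ht : ∀ x ∈ t, x < m') (hm : m ≤ m') : Precedes (insert m s) (insert m' t) := by
  obtain ⟨d, a, b, ha, hb, rfl, rfl, hab⟩ := h
  refine ⟨d + 1, Fin.snoc a m, Fin.snoc b m', strictMono_snoc ha fun i => hs _ (by simp),
    strictMono_snoc hb fun i => ht _ (by simp), image_snoc a m, image_snoc b m', fun i => ?_⟩
  induction i using Fin.lastCases with
  | last => simpa using hm
  | cast i => simpa using hab i

/-- An extension of `s` by `m` spreads to the extension of `t` by every large `m' ∈ M`. -/
theorem IsSpreadingOn.iterDerivFamily {M : Set ℕ} {B : Set (Finset ℕ)}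
    (hB : IsSpreadingOn M B) (hh : IsHereditary B) (hM : M.Infinite) (α : Ordinal.{0}) :
    IsSpreadingOn M (iterDerivFamily B α) := by
  refine ⟨fun s hs => hB.1 s (iterDerivFamily_subset _ _ hs), ?_⟩
  induction α using WellFoundedLT.induction with
  | ind α ih =>
    intro s t hst htM hs
    rw [mem_iterDerivFamily_iff hh] at hs ⊢
    refine ⟨hB.2 s t hst htM hs.1, fun β hβ => ?_⟩
    obtain ⟨m, hm, hmB⟩ := (hs.2 β hβ).exists
    have hfr : ∃ᶠ b in atTop, b ∈ M := Nat.frequently_atTop_iff_infinite.2 hM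
    refine (hfr.and_eventually ((eventually_ge_atTop m).and
      (eventually_gt_atTop (t.sup id)))).mono ?_
    rintro m' ⟨hm'M, hmm', hm't⟩
    have hlt : ∀ x ∈ t, x < m' := fun x hx => (Finset.le_sup (f := id) hx).trans_lt hm't
    refine ⟨hlt, ih β hβ _ _ (hst.insert hm hlt hmm') ?_ hmB⟩
    rw [Finset.coe_insert]
    exact Set.insert_subset hm'M htM

/-- In a spreading family, one extension of `t` by a larger element gives all later ones. -/
theorem IsSpreadingOn.eventually_insert_mem {M : Set ℕ} {B : Set (Finset ℕ)}
    (hB : IsSpreadingOn M B) {t : Finset ℕ} {m : ℕ} (hm : ∀ x ∈ t, x < m)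
    (h : insert m t ∈ B) : ∀ᶠ b in atTop, b ∈ M → insert b t ∈ B := by
  filter_upwards [eventually_ge_atTop m] with b hb hbM
  refine hB.2 _ _ ((precedes_refl t).insert hm (fun x hx => (hm x hx).trans_le hb) hb) ?_ h
  rw [Finset.coe_insert]
  exact Set.insert_subset hbM fun x hx => hB.1 _ h (Finset.mem_insert_of_mem hx)

/-! ### Comparing ranks of sets in two families -/

/-- Some derivative separates `t`, as a member of `B`, from `u`, as a member of `F`. -/
def RankGT (B F : Set (Finset ℕ)) (t u : Finset ℕ) : Prop :=
  ∃ β : Ordinal.{0}, t ∈ iterDerivFamily B β ∧ u ∉ iterDerivFamily F β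

/-- Since `u ∉ ∂⁽ᵝ⁾F`, some `γ < β` excludes all late extensions of `u` from `∂⁽ᵞ⁾F`, whereas
spreading puts all late extensions of `t` within `M` into `∂⁽ᵞ⁾B`. -/
theorem eventually_rankGT_insert {M : Set ℕ} {B F : Set (Finset ℕ)} (hF : IsHereditary F)
    (hB : IsSpreadingOn M B) (hh : IsHereditary B) (hM : M.Infinite) {t u : Finset ℕ}
    (hu : u ∈ F) (h : RankGT B F t u) :
    ∀ᶠ b in atTop, ∀ m ≥ b, ∀ m' ≥ b, m ∈ M → RankGT B F (insert m t) (insert m' u) := by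
  obtain ⟨β, ht, huβ⟩ := h
  rw [mem_iterDerivFamily_iff hF] at huβ
  push Not at huβ
  obtain ⟨γ, hγ, hγu⟩ := huβ hu
  obtain ⟨x, hx, hxB⟩ := (((mem_iterDerivFamily_iff hh).1 ht).2 γ hγ).exists
  filter_upwards [eventually_forall_ge_atTop.2
    ((hB.iterDerivFamily hh hM γ).eventually_insert_mem hx hxB),
    eventually_forall_ge_atTop.2 hγu, eventually_gt_atTop (u.sup id)] with b h1 h2 h3 m hm m' hm' hmM
  exact ⟨γ, h1 m hm hmM, h2 m' hm' fun x hx =>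
    ((Finset.le_sup (f := id) hx).trans_lt h3).trans_le hm'⟩

theorem not_mem_initMax_of_rankGT {B F : Set (Finset ℕ)} (hh : IsHereditary B) {t u : Finset ℕ}
    (hu : u ∈ F) (h : RankGT B F t u) : t ∉ initMax B := by
  obtain ⟨β, ht, huβ⟩ := h
  have hβ : 0 < β := by
    rw [pos_iff_ne_zero]
    rintro rfl
    exact huβ (by rwa [iterDerivFamily_zero])
  obtain ⟨m, hm, hmB⟩ := (((mem_iterDerivFamily_iff hh).1 ht).2 0 hβ).exists
  intro hmax
  have heq := hmax.2 (insert m t) (iterDerivFamily_subset _ _ hmB)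
    ⟨Finset.subset_insert m t, fun a ha b hb hbt => by
      rcases Finset.mem_insert.1 hb with rfl | hb
      · exact hm a ha
      · exact absurd hb hbt⟩
  exact (hm m (heq ▸ Finset.mem_insert_self m t)).false

theorem exists_not_admissible_of_cbIndex_lt {F : Set (Finset ℕ)} (hFc : IsCompactFamily F)
    (hFh : IsHereditary F) {M : Set ℕ} (hM : M.Infinite) {B : Set (Finset ℕ)}
    (hB : IsRegularOn M B) (hlt : cbIndex F < cbIndex B) :
    ∃ N : Set ℕ, N ⊆ M ∧ N.Infinite ∧
      ∀ (n : ℕ) (s : Fin n → Finset ℕ), (∀ i, (s i : Set ℕ) ⊆ N) → (∀ i, 2 ≤ (s i).card) →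
        Admissible (restrictFamily (initMax B) N) s → ¬ Admissible F s := by
  obtain ⟨-, hh, hsp⟩ := hB
  obtain ⟨x, hx⟩ := exists_singleton_mem_of_lt_cbIndex hh hlt
  have h₀ : ∀ᶠ b in atTop, ∀ m ≥ b, m ∈ M → {m} ∈ iterDerivFamily B (cbIndex F) :=
    eventually_forall_ge_atTop.2
      ((hsp.iterDerivFamily hh hM (cbIndex F)).eventually_insert_mem (t := ∅) (by simp) hx)
  -- There are finitely many pairs of subsets of `[0, a]`, so one threshold serves them all.
  have hstep : ∀ (k a : ℕ), ∀ᶠ b in atTop, ∀ t ∈ (Finset.range (a + 1)).powerset,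
      ∀ u ∈ (Finset.range (a + 1)).powerset, u ∈ F → RankGT B F t u →
        ∀ m ≥ b, ∀ m' ≥ b, m ∈ M → RankGT B F (insert m t) (insert m' u) := by
    intro k a
    simp only [eventually_all_finset, eventually_imp_distrib_left]
    exact fun t _ u _ hu h => eventually_rankGT_insert hFh hsp hh hM hu h
  obtain ⟨N, hN, hNM, hN₀, hNs⟩ := hM.exists_sparse h₀ hstep
  refine ⟨Set.range N, Set.range_subset_iff.2 hNM, Set.infinite_range_of_injective hN.injective, ?_⟩
  rintro n s hsN hs2 ⟨⟨hne, -⟩, T, ⟨hT, hTN⟩, t, ht, rfl, htle, htlt⟩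
    ⟨-, U, hU, u, hu, rfl, hule, hult⟩
  have htN : ∀ i, t i ∈ Set.range N := fun i => hTN (by simp)
  rcases n.eq_zero_or_pos with rfl | hn
  · have h := hT.2 {x} (iterDerivFamily_subset _ _ hx) ⟨by simp, by simp⟩
    simp at h
  have key : ∀ j, j < n → RankGT B F (headImage t (j + 1)) (headImage u (j + 1)) := by
    intro j
    induction j with
    | zero =>
      intro hj
      rw [headImage_succ t hj, headImage_succ u hj, headImage_zero, headImage_zero]
      obtain ⟨k, hk⟩ := htN ⟨0, hj⟩
      refine ⟨cbIndex F, ?_, fun h => ?_⟩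
      · rw [← hk]
        exact hN₀ (N k) (hN.monotone k.zero_le) (hNM k)
      · have := hFc.iterDerivFamily_cbIndex hFh h
        simp at this
    | succ j ih =>
      intro hj
      have hj' : j < n := (Nat.lt_succ_self j).trans hj
      -- Two elements `N k < N l` of the block provide the gap: both heads lie in `[0, N k]`, and
      -- both next points exceed `N l ≥ N (k + 1)`.
      obtain ⟨a, ha, b, hb, hab⟩ := Finset.one_lt_card.1 (hs2 ⟨j, hj'⟩)
      wlog hlt' : a < b generalizing a b
      · exact this b hb a ha hab.symm (lt_of_le_of_ne (not_lt.1 hlt') hab.symm)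
      obtain ⟨k, rfl⟩ := hsN _ ha
      obtain ⟨l, rfl⟩ := hsN _ hb
      have hkl : N (k + 1) ≤ N l := hN.monotone (hN.lt_iff_lt.1 hlt')
      have hlast : (⟨j, hj'⟩ : Fin n) < ⟨j + 1, hj⟩ := Nat.lt_succ_self j
      have hhead : ∀ m : Fin n → ℕ, StrictMono m → (∀ i, ∀ a ∈ s i, m i ≤ a) →
          headImage m (j + 1) ∈ (Finset.range (N k + 1)).powerset := by
        intro m hm hle
        refine Finset.mem_powerset.2 fun y hy => ?_
        obtain ⟨i, hi, rfl⟩ := mem_headImage.1 hy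
        have h1 : m i ≤ m ⟨j, hj'⟩ := hm.monotone (Nat.lt_succ_iff.1 hi)
        exact Finset.mem_range.2 (Nat.lt_succ_of_le (h1.trans (hle _ _ ha)))
      rw [headImage_succ t hj, headImage_succ u hj]
      exact hNs k _ (hhead t ht htle) _ (hhead u hu hule) (hFh _ _ (headImage_subset u _) hU)
        (ih hj') _ (hkl.trans (htlt _ _ hlast _ hb).le) _ (hkl.trans (hult _ _ hlast _ hb).le)
        (Set.range_subset_iff.2 hNM (htN _))
  have hlast := key (n - 1) (Nat.sub_lt hn one_pos)
  rw [Nat.sub_add_cancel (show 1 ≤ n from hn), headImage_self, headImage_self] at hlast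
  exact not_mem_initMax_of_rankGT hh hU hlast hT

/-! ### Regular families of prescribed index -/

/-- `g` labels the elements of `s` by ordinals in `[β, ι)` that strictly decrease along `s` and
whose height `h` is bounded by the element labelled. -/
def IsLabelling (h : Ordinal.{0} → ℕ) (β ι : Ordinal.{0}) (s : Finset ℕ)
    (g : ℕ → Ordinal.{0}) : Prop :=
  (∀ x ∈ s, β ≤ g x ∧ g x < ι ∧ h (g x) ≤ x) ∧ ∀ x ∈ s, ∀ y ∈ s, x < y → g y < g x

/-- The sets that can be labelled by strictly decreasing ordinals below `ι`, with heights `h`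
bounded by the elements. -/
def descFamily (h : Ordinal.{0} → ℕ) (ι : Ordinal.{0}) : Set (Finset ℕ) :=
  {s | ∃ g, IsLabelling h 0 ι s g}

theorem IsLabelling.subset {h : Ordinal.{0} → ℕ} {β ι : Ordinal.{0}} {s t : Finset ℕ}
    {g : ℕ → Ordinal.{0}} (hg : IsLabelling h β ι t g) (hst : s ⊆ t) : IsLabelling h β ι s g :=
  ⟨fun x hx => hg.1 x (hst hx), fun x hx y hy => hg.2 x (hst hx) y (hst hy)⟩

theorem IsLabelling.insert {h : Ordinal.{0} → ℕ} {β γ ι : Ordinal.{0}} {s : Finset ℕ}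
    {g : ℕ → Ordinal.{0}} (hg : IsLabelling h β ι s g) (hγβ : γ < β) (hγι : γ < ι) {m : ℕ}
    (hm : ∀ x ∈ s, x < m) (hγm : h γ ≤ m) :
    IsLabelling h γ ι (insert m s) (Function.update g m γ) := by
  have hg' : ∀ x ∈ s, Function.update g m γ x = g x := fun x hx =>
    Function.update_of_ne (hm x hx).ne _ _
  constructor
  · intro x hx
    rcases Finset.mem_insert.1 hx with rfl | hx
    · simpa using ⟨hγι, hγm⟩
    · rw [hg' x hx]
      exact ⟨hγβ.le.trans (hg.1 x hx).1, (hg.1 x hx).2⟩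
  · intro x hx y hy hxy
    rcases Finset.mem_insert.1 hx with rfl | hxs
    · rcases Finset.mem_insert.1 hy with rfl | hy
      · exact absurd hxy (lt_irrefl _)
      · exact absurd hxy (hm y hy).not_gt
    · rw [hg' x hxs]
      rcases Finset.mem_insert.1 hy with rfl | hys
      · simpa using hγβ.trans_le (hg.1 x hxs).1
      · rw [hg' y hys]
        exact hg.2 x hxs y hys hxy

theorem isHereditary_descFamily (h : Ordinal.{0} → ℕ) (ι : Ordinal.{0}) :
    IsHereditary (descFamily h ι) := fun _ _ hst ⟨g, hg⟩ => ⟨g, hg.subset hst⟩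

theorem isSpreadingOn_descFamily (h : Ordinal.{0} → ℕ) (ι : Ordinal.{0}) :
    IsSpreadingOn Set.univ (descFamily h ι) := by
  refine ⟨fun _ _ => Set.subset_univ _, ?_⟩
  rintro s t ⟨d, a, b, ha, hb, rfl, rfl, hab⟩ - ⟨g, hg1, hg2⟩
  have hext : ∀ i, Function.extend b (g ∘ a) 0 (b i) = g (a i) := fun i =>
    hb.injective.extend_apply _ _ i
  simp only [Finset.mem_image, Finset.mem_univ, true_and, forall_exists_index,
    forall_apply_eq_imp_iff] at hg1 hg2
  refine ⟨Function.extend b (g ∘ a) 0, ?_, ?_⟩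
  · simp only [Finset.mem_image, Finset.mem_univ, true_and, forall_exists_index,
      forall_apply_eq_imp_iff, hext]
    exact fun i => ⟨(hg1 i).1, (hg1 i).2.1, (hg1 i).2.2.trans (hab i)⟩
  · simp only [Finset.mem_image, Finset.mem_univ, true_and, forall_exists_index,
      forall_apply_eq_imp_iff, hext]
    exact fun i j hij => hg2 i j (ha (hb.lt_iff_lt.1 hij))

/-- Finitely many ordinals can label `min X`. With `μ` the largest, the rest of `X` is labelled
below `μ`, and induction on `ι` applies. -/
theorem finite_of_forall_mem_descFamily {h : Ordinal.{0} → ℕ} {ι : Ordinal.{0}}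
    (hfin : ∀ k, {γ | γ < ι ∧ h γ ≤ k}.Finite) {X : Set ℕ}
    (hX : ∀ s : Finset ℕ, (s : Set ℕ) ⊆ X → s ∈ descFamily h ι) : X.Finite := by
  induction ι using WellFoundedLT.induction generalizing X with
  | ind ι ih =>
    rcases X.eq_empty_or_nonempty with rfl | hne
    · exact Set.finite_empty
    have hx₀ : sInf X ∈ X := Nat.sInf_mem hne
    have hT : {γ | γ < ι ∧ h γ ≤ sInf X}.Nonempty := by
      obtain ⟨g, hg⟩ := hX {sInf X} (by simpa using hx₀)
      exact ⟨g (sInf X), (hg.1 _ (by simp)).2⟩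
    obtain ⟨μ, hμ, hmax⟩ := Set.exists_max_image _ id (hfin (sInf X)) hT
    have hfinμ : ∀ k, {γ | γ < μ ∧ h γ ≤ k}.Finite := fun k =>
      (hfin k).subset fun γ hγ => ⟨hγ.1.trans hμ.1, hγ.2⟩
    have hrest : (X \ {sInf X}).Finite := by
      refine ih μ hμ.1 hfinμ fun s hs => ?_
      obtain ⟨g, hg⟩ := hX (insert (sInf X) s) (by
        rw [Finset.coe_insert]
        exact Set.insert_subset hx₀ fun x hx => (hs hx).1)
      have hg₀ := hg.1 _ (Finset.mem_insert_self _ _)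
      refine ⟨g, fun x hx => ⟨zero_le, ?_, (hg.1 x (Finset.mem_insert_of_mem hx)).2.2⟩,
        (hg.subset (Finset.subset_insert _ _)).2⟩
      exact (hg.2 _ (Finset.mem_insert_self _ _) x (Finset.mem_insert_of_mem hx)
        (lt_of_le_of_ne (Nat.sInf_le (hs hx).1) (Ne.symm (hs hx).2))).trans_le
          (hmax (g (sInf X)) hg₀.2)
    exact (hrest.insert (sInf X)).subset fun x hx => by
      by_cases hxe : x = sInf X
      · exact Or.inl hxe
      · exact Or.inr ⟨hx, hxe⟩

theorem isRegularFamily_descFamily {h : Ordinal.{0} → ℕ} {ι : Ordinal.{0}}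
    (hfin : ∀ k, {γ | γ < ι ∧ h γ ≤ k}.Finite) : IsRegularFamily (descFamily h ι) :=
  ⟨(isHereditary_descFamily h ι).isCompactFamily fun _ hX =>
      finite_of_forall_mem_descFamily hfin hX,
    isHereditary_descFamily h ι, isSpreadingOn_descFamily h ι⟩

/-- When all labels are at least `β`, any `γ < β` can label any sufficiently late new element. -/
theorem mem_iterDerivFamily_descFamily_of_isLabelling {h : Ordinal.{0} → ℕ}
    {β ι : Ordinal.{0}} (hβ : β ≤ ι) {s : Finset ℕ} {g : ℕ → Ordinal.{0}}
    (hg : IsLabelling h β ι s g) : s ∈ iterDerivFamily (descFamily h ι) β := by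
  induction β using WellFoundedLT.induction generalizing s g with
  | ind β ih =>
    refine (mem_iterDerivFamily_iff (isHereditary_descFamily h ι)).2
      ⟨⟨g, fun x hx => ⟨zero_le, (hg.1 x hx).2⟩, hg.2⟩, fun γ hγ => Eventually.frequently ?_⟩
    filter_upwards [eventually_ge_atTop (h γ), eventually_gt_atTop (s.sup id)] with m hm1 hm2
    have hm : ∀ x ∈ s, x < m := fun x hx => (Finset.le_sup (f := id) hx).trans_lt hm2
    exact ⟨hm, ih γ hγ (hγ.le.trans hβ) (hg.insert hγ (hγ.trans_le hβ) hm hm1)⟩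

theorem exists_isLabelling_of_mem_iterDerivFamily {h : Ordinal.{0} → ℕ} {β ι : Ordinal.{0}}
    (hfin : ∀ k, {γ | γ < ι ∧ h γ ≤ k}.Finite) {s : Finset ℕ} {x : ℕ} (hx : x ∈ s)
    (hmax : ∀ y ∈ s, y ≤ x) (hs : s ∈ iterDerivFamily (descFamily h ι) β) :
    ∃ g, IsLabelling h 0 ι s g ∧ β ≤ g x := by
  induction β using WellFoundedLT.induction generalizing s x with
  | ind β ih =>
    let T : Set Ordinal.{0} := {γ | ∃ g, IsLabelling h 0 ι s g ∧ g x = γ}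
    have hTfin : T.Finite := (hfin x).subset (by
      rintro _ ⟨g, hg, rfl⟩
      exact (hg.1 x hx).2)
    rw [mem_iterDerivFamily_iff (isHereditary_descFamily h ι)] at hs
    obtain ⟨g₀, hg₀⟩ := hs.1
    -- Each `γ < β` gives its own labelling with label above `γ` at `x`; one maximizing the label at
    -- `x` serves every `γ`.
    obtain ⟨_, ⟨g, hg, rfl⟩, hgmax⟩ := Set.exists_max_image T id hTfin ⟨g₀ x, g₀, hg₀, rfl⟩
    refine ⟨g, hg, le_of_forall_lt fun γ hγ => ?_⟩
    obtain ⟨m, hm, hmB⟩ := (hs.2 γ hγ).exists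
    obtain ⟨g', hg', hγ'⟩ := ih γ hγ (Finset.mem_insert_self m s) (by
      intro y hy
      rcases Finset.mem_insert.1 hy with rfl | hy
      · exact le_rfl
      · exact (hm y hy).le) hmB
    exact (hγ'.trans_lt (hg'.2 x (Finset.mem_insert_of_mem hx) m (Finset.mem_insert_self m s)
      (hm x hx))).trans_le (hgmax (g' x) ⟨g', hg'.subset (Finset.subset_insert m s), rfl⟩)

theorem cbIndex_descFamily {h : Ordinal.{0} → ℕ} {ι : Ordinal.{0}}
    (hfin : ∀ k, {γ | γ < ι ∧ h γ ≤ k}.Finite) : cbIndex (descFamily h ι) = ι := by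
  refine cbIndex_eq (fun s hs => ?_) fun γ hγ hsub => ?_
  · by_contra hne
    have hne' : s.Nonempty := Finset.nonempty_iff_ne_empty.2 hne
    obtain ⟨g, hg, hle⟩ := exists_isLabelling_of_mem_iterDerivFamily hfin (s.max'_mem hne')
      (fun y hy => s.le_max' y hy) hs
    exact (hg.1 _ (s.max'_mem hne')).2.1.not_ge hle
  · have hmem : {h γ} ∈ iterDerivFamily (descFamily h ι) γ :=
      mem_iterDerivFamily_descFamily_of_isLabelling (g := fun _ => γ) hγ.le
        ⟨fun x hx => by simp_all, fun x hx y hy hxy => by simp_all⟩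
    simpa using hsub hmem

theorem regular_empty : IsRegularFamily ∅ :=
  ⟨by simp [IsCompactFamily], fun _ _ _ h => h, by simp, fun _ _ _ _ h => h⟩

/-! ### Interpolation -/

theorem exists_regular_admissible {F : Set (Finset ℕ)} (hFc : IsCompactFamily F)
    (hFh : IsHereditary F) {M : Set ℕ} (hM : M.Infinite) :
    ∃ B : Set (Finset ℕ), IsRegularFamily B ∧ cbIndex B = cbIndex F ∧
      ∃ N : Set ℕ, N ⊆ M ∧ N.Infinite ∧
        ∀ (n : ℕ) (s : Fin n → Finset ℕ), (∀ i, (s i : Set ℕ) ⊆ N) →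
          Admissible B s → Admissible F s := by
  rcases F.eq_empty_or_nonempty with rfl | ⟨s₀, hs₀⟩
  -- `descFamily` always contains `∅`, which would make the empty sequence admissible, so an empty
  -- `F` is treated apart.
  · exact ⟨∅, regular_empty, rfl, M, subset_rfl, hM, fun _ _ _ h => h⟩
  obtain ⟨h₀, hinj⟩ := Set.countable_iff_exists_injOn.1 (hFc.countable_Iio_cbIndex hFh)
  have hT : ∀ k, {γ | γ < cbIndex F ∧ h₀ γ ≤ k}.Finite := fun k =>
    Set.Finite.of_finite_image ((Set.finite_Iic k).subset (by rintro _ ⟨γ, hγ, rfl⟩; exact hγ.2))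
      (hinj.mono fun γ hγ => hγ.1)
  have hinit : ∀ k, ∀ᶠ b in atTop, ∀ γ ∈ {γ | γ < cbIndex F ∧ h₀ γ ≤ k},
      ∃ u ≤ b, {u} ∈ iterDerivFamily F γ := by
    intro k
    refine (eventually_all_finite (hT k)).2 fun γ hγ => ?_
    obtain ⟨u, hu⟩ := exists_singleton_mem_of_lt_cbIndex hFh hγ.1
    filter_upwards [eventually_ge_atTop u] with b hb using ⟨u, hb, hu⟩
  have hext : ∀ k a, ∀ᶠ b in atTop, ∀ γ ∈ {γ | γ < cbIndex F ∧ h₀ γ ≤ k},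
      ∀ u ∈ (Finset.range (a + 1)).powerset,
        (∃ᶠ m in atTop, (∀ x ∈ u, x < m) ∧ insert m u ∈ iterDerivFamily F γ) →
          ∃ m, a < m ∧ m ≤ b ∧ insert m u ∈ iterDerivFamily F γ := by
    intro k a
    refine (eventually_all_finite (hT k)).2 fun γ hγ => ?_
    simp only [eventually_all_finset, eventually_imp_distrib_left]
    intro u _ hfr
    obtain ⟨m, ⟨-, hm⟩, ham⟩ := (hfr.and_eventually (eventually_gt_atTop a)).exists
    filter_upwards [eventually_ge_atTop m] with b hb using ⟨m, ham, hb, hm⟩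
  obtain ⟨N, hN, hNM, hN₀, hNs⟩ :=
    hM.exists_sparse (hinit 0) fun k a => (hinit (k + 1)).and (hext (k + 1) a)
  have hNinit : ∀ k, ∀ γ ∈ {γ | γ < cbIndex F ∧ h₀ γ ≤ k},
      ∃ u ≤ N k, {u} ∈ iterDerivFamily F γ := by
    intro k
    cases k with
    | zero => exact hN₀
    | succ k => exact (hNs k).1
  -- The height is `N ∘ h₀` so that a label on a point at most `N k` has code at most `k`, within
  -- reach of the thresholds built into `N`.
  have hfin : ∀ k, {γ | γ < cbIndex F ∧ N (h₀ γ) ≤ k}.Finite := fun k =>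
    (hT k).subset fun γ hγ => ⟨hγ.1, (hN.le_apply (x := h₀ γ)).trans hγ.2⟩
  refine ⟨descFamily (fun γ => N (h₀ γ)) (cbIndex F), isRegularFamily_descFamily hfin,
    cbIndex_descFamily hfin, Set.range N, Set.range_subset_iff.2 hNM,
    Set.infinite_range_of_injective hN.injective, ?_⟩
  rintro n s hsN ⟨⟨hne, hlt⟩, T, ⟨g, hg⟩, t, ht, rfl, htle, -⟩
  have hlabel : ∀ i k, N k ∈ s i → g (t i) ∈ {γ | γ < cbIndex F ∧ h₀ γ ≤ k} := fun i k hk =>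
    ⟨(hg.1 _ (by simp)).2.1, hN.le_iff_le.1 ((hg.1 (t i) (by simp)).2.2.trans (htle i _ hk))⟩
  have key : ∀ j (hj : j < n), ∃ m : Fin n → ℕ,
      (∀ i : Fin n, i.val ≤ j → (∀ a ∈ s i, m i ≤ a) ∧ ∀ i' < i, ∀ a ∈ s i', a < m i) ∧
        headImage m (j + 1) ∈ iterDerivFamily F (g (t ⟨j, hj⟩)) := by
    intro j
    induction j with
    | zero =>
      intro hj
      obtain ⟨k, hk⟩ := hsN ⟨0, hj⟩ ((s _).min'_mem (hne _))
      obtain ⟨u, hu, huF⟩ := hNinit k _ (hlabel ⟨0, hj⟩ k (hk ▸ (s _).min'_mem (hne _)))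
      refine ⟨fun _ => u, fun i hi => ?_, ?_⟩
      · obtain rfl : i = ⟨0, hj⟩ := Fin.ext (Nat.le_zero.1 hi)
        refine ⟨fun a ha => hu.trans (hk ▸ (s _).min'_le a ha), fun i' hi' => ?_⟩
        exact absurd hi' (Nat.not_lt_zero _)
      · rw [headImage_succ _ hj, headImage_zero]
        exact huF
    | succ j ih =>
      intro hj
      have hj' : j < n := (Nat.lt_succ_self j).trans hj
      obtain ⟨m, hm, hmF⟩ := ih hj'
      have hmin := (s ⟨j + 1, hj⟩).min'_mem (hne _)
      obtain ⟨k, hk⟩ := hsN ⟨j + 1, hj⟩ hmin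
      have hbelow : ∀ i : Fin n, i.val ≤ j → ∀ a ∈ s i, a < N k := fun i hi a ha =>
        hk ▸ hlt i ⟨j + 1, hj⟩ (Nat.lt_succ_of_le hi) a ha _ hmin
      -- The earlier blocks lie in `N` below the present minimum, hence at or below its predecessor
      -- in `N`; the next point is sought between these two.
      obtain ⟨k, rfl⟩ : ∃ l, k = l + 1 := by
        refine Nat.exists_eq_succ_of_ne_zero ?_
        rintro rfl
        obtain ⟨a, ha⟩ := hne ⟨j, hj'⟩
        obtain ⟨l, rfl⟩ := hsN _ ha
        exact (hbelow _ le_rfl _ ha).not_ge (hN.monotone l.zero_le)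
      have hbelow' : ∀ i : Fin n, i.val ≤ j → ∀ a ∈ s i, a ≤ N k := fun i hi a ha => by
        obtain ⟨l, rfl⟩ := hsN _ ha
        exact hN.monotone (Nat.lt_succ_iff.1 (hN.lt_iff_lt.1 (hbelow i hi _ ha)))
      have hhead : headImage m (j + 1) ∈ (Finset.range (N k + 1)).powerset := by
        refine Finset.mem_powerset.2 fun y hy => ?_
        obtain ⟨i, hi, rfl⟩ := mem_headImage.1 hy
        obtain ⟨a, ha⟩ := hne i
        have hi' := Nat.lt_succ_iff.1 hi
        exact Finset.mem_range.2
          (Nat.lt_succ_of_le (((hm i hi').1 a ha).trans (hbelow' i hi' a ha)))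
      have hdesc : g (t ⟨j + 1, hj⟩) < g (t ⟨j, hj'⟩) :=
        hg.2 _ (by simp) _ (by simp) (ht (Nat.lt_succ_self j))
      obtain ⟨b, hb1, hb2, hbF⟩ := (hNs k).2 _ (hlabel ⟨j + 1, hj⟩ (k + 1) (hk ▸ hmin)) _ hhead
        (((mem_iterDerivFamily_iff hFh).1 hmF).2 _ hdesc)
      refine ⟨Function.update m ⟨j + 1, hj⟩ b, fun i hi => ?_, ?_⟩
      · rcases Nat.le_succ_iff.1 hi with h | h
        · rw [Function.update_of_ne (by rintro rfl; exact Nat.not_succ_le_self _ h)]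
          exact hm i h
        · obtain rfl : i = ⟨j + 1, hj⟩ := Fin.ext h
          rw [Function.update_self]
          exact ⟨fun a ha => hb2.trans (hk ▸ (s _).min'_le a ha), fun i' hi' a ha =>
            (hbelow' i' (Nat.lt_succ_iff.1 hi') a ha).trans_lt hb1⟩
      · rw [headImage_update m hj]
        exact hbF
  refine ⟨⟨hne, hlt⟩, ?_⟩
  rcases n.eq_zero_or_pos with rfl | hn
  · exact ⟨∅, hFh _ s₀ (Finset.empty_subset _) hs₀, finZeroElim, fun i => i.elim0, by simp,
      fun i => i.elim0, fun i => i.elim0⟩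
  obtain ⟨m, hm, hmF⟩ := key (n - 1) (Nat.sub_lt hn one_pos)
  have hle : ∀ i : Fin n, i.val ≤ n - 1 := fun i => Nat.le_sub_one_of_lt i.isLt
  rw [Nat.sub_add_cancel (show 1 ≤ n from hn), headImage_self] at hmF
  refine ⟨_, iterDerivFamily_subset _ _ hmF, m, fun i j hij => ?_, rfl,
    fun i => (hm i (hle i)).1, fun i j hij => (hm j (hle j)).2 i hij⟩
  obtain ⟨a, ha⟩ := hne i
  exact ((hm i (hle i)).1 a ha).trans_lt ((hm j (hle j)).2 i hij a ha)

theorem mainTheorem8 (F : Set (Finset ℕ)) (hFc : IsCompactFamily F) (hFh : IsHereditary F)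
    (M : Set ℕ) (hM : M.Infinite) :
    (∃ B : Set (Finset ℕ), IsRegularFamily B ∧ cbIndex B = cbIndex F ∧
      ∃ N : Set ℕ, N ⊆ M ∧ N.Infinite ∧
        ∀ (n : ℕ) (s : Fin n → Finset ℕ), (∀ i, (s i : Set ℕ) ⊆ N) →
          Admissible B s → Admissible F s) ∧
    (∀ B : Set (Finset ℕ), IsRegularOn M B → cbIndex F < cbIndex B →
      ∃ N : Set ℕ, N ⊆ M ∧ N.Infinite ∧
        ∀ (n : ℕ) (s : Fin n → Finset ℕ), (∀ i, (s i : Set ℕ) ⊆ N) → (∀ i, 2 ≤ (s i).card) →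
          Admissible (restrictFamily (initMax B) N) s → ¬ Admissible F s) :=
  ⟨exists_regular_admissible hFc hFh hM,
    fun _ hB hlt => exists_not_admissible_of_cbIndex_lt hFc hFh hM hB hlt⟩
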